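/- Let $N\in\mathbb N$, let $\mathcal H=L^2(\mathbb R^N)$, write phase space vectors as $\mathbf x=(q_1,p_1,\dots,q_N,p_N)^T\in\mathbb R^{2N}$, let $\mathbf\Omega_N=\bigoplus_{j=1}^N\begin{pmatrix}0&1\\-1&0\end{pmatrix}$, and let $W(\mathbf x)=e^{-i\mathbf x^T\mathbf\Omega_N\mathbf R}$ with $\mathbf R=(Q_1,P_1,\dots,Q_N,P_N)^T$ be the Weyl operators, i.e. $(W(\mathbf x)\psi)(t)=e^{i(p\cdot t-\frac12 p\cdot q)}\psi(t-q)$. An observable with values in $\mathbb R^{2N}$ is a map $\mathsf E$ from the Borel sets $\mathcal B(\mathbb R^{2N})$ to the bounded operators on $\mathcal H$ with $\mathsf E(X)\ge 0$, $\mathsf E(\mathbb R^{2N})=I$, and which is $\sigma$-additive in the weak operator topology. It is \emph{Gaussian} with parameters $(\mathbf A_0,\mathbf B_0,\mathbf v_0)$, where $\mathbf A_0,\mathbf B_0$ are real $2N\times 2N$ matrices with $\mathbf B_0-i\mathbf A_0^T\mathbf\Omega_N\mathbf A_0\ge 0$ and $\mathbf v_0\in\mathbb R^{2N}$, if $$\int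 e^{i\mathbf p^T\mathbf x}\,\mathsf E(d\mathbf x)=W(\mathbf A_0\mathbf p)\,e^{-\frac14\mathbf p^T\mathbf B_0\mathbf p-i\mathbf v_0^T\mathbf p}\qquad\text{for all }\mathbf p\in\mathbb R^{2N}.$$ It is \emph{informationally complete} if two states (positive operators of trace one) $\rho,\sigma$ with $\operatorname{tr}[\rho\,\mathsf E(X)]=\operatorname{tr}[\sigma\,\mathsf E(X)]$ for all Borel sets $X$ are equal. It is \emph{covariant} if $W(\mathbf x)\mathsf E(X)W(\mathbf x)^*=\mathsf E(X+\mathbf x)$ for all $\mathbf x\in\mathbb R^{2N}$ and all Borel sets $X$. For an invertible real $2N\times 2N$ matrix $\mathbf P$, the observable $\mathsf E_{\mathbf P}(X)=\mathsf E(\{\mathbf y\mid \mathbf P\mathbf y\in X\})$ is called a \emph{bijective linear postprocessing} of $\mathsf E$. Then a Gaussian observable $\mathsf E$ with values in $\mathbb R^{2N}$ is informationally complete if and only if it is a bijective linear postprocessing of a covariant Gaussian observable, i.e. if and only if there are a covariant Gaussian observable $\mathsf F$ with values in $\mathbb R^{2N}$ and an invertible matrix $\mathbf P$ with $\mathsf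 E=\mathsf F_{\mathbf P}$. Moreover, a Gaussian observable with values in $\mathbb R^{2N}$ and parameters $(\mathbf A_0,\mathbf B_0,\mathbf v_0)$ is covariant if and only if $\mathbf A_0=-\mathbf\Omega_N$. -/

import Mathlib

open MeasureTheory
open scoped InnerProductSpace ComplexOrder Kronecker Matrix

noncomputable section

namespace GaussianObs

/-! ### States and observables on a complex Hilbert space -/

section General

variable {H : Type*} [NormedAddCommGroup H] [InnerProductSpace ℂ H] [CompleteSpace H]

variable (H) in
/-- The index set of a fixed Hilbert basis of `H`. -/
def basisIndex : Set H := (exists_hilbertBasis ℂ H).choose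

variable (H) in
/-- A fixed Hilbert basis of `H`. -/
def basis : HilbertBasis (basisIndex H) ℂ H := (exists_hilbertBasis ℂ H).choose_spec.choose

/-- The trace `∑ ⟨e, T e⟩` over a Hilbert basis. It is only used for trace class operators,
for which the series converges and does not depend on the basis. -/
def trace (T : H →L[ℂ] H) : ℂ := ∑' i, ⟪basis H i, T (basis H i)⟫_ℂ

/-- States: positive operators of trace one. (A divergent series has the value `0`, so a positive
operator with `trace ρ = 1` is trace class.) -/
def IsState (ρ : H →L[ℂ] H) : Prop := ρ.IsPositive ∧ trace ρ = 1

/-- Observables with values in `ℝ^ι`: normalized positive operator valued measures on the Borel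
sets of `ℝ^ι`, σ-additive in the weak operator topology. The value on non-measurable sets, which
carries no information, is set to `0`, so that equality means equality on all Borel sets. -/
@[ext]
structure Observable (ι : Type*) (H : Type*) [NormedAddCommGroup H] [InnerProductSpace ℂ H]
    [CompleteSpace H] where
  eff : Set (ι → ℝ) → H →L[ℂ] H
  not_measurable : ∀ X, ¬ MeasurableSet X → eff X = 0
  positive : ∀ X, MeasurableSet X → (eff X).IsPositive
  normalized : eff Set.univ = 1
  sigma_additive : ∀ X : ℕ → Set (ι → ℝ), (∀ j, MeasurableSet (X j)) →
    Pairwise (Function.onFun Disjoint X) →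
    ∀ φ ψ : H, HasSum (fun j => ⟪φ, eff (X j) ψ⟫_ℂ) ⟪φ, eff (⋃ j, X j) ψ⟫_ℂ

namespace Observable

variable {ι κ : Type*}

/-- An observable is informationally complete if each state `ρ` is determined by its outcome
distribution `X ↦ tr (ρ E(X))`. -/
def InformationallyComplete (E : Observable ι H) : Prop :=
  ∀ ρ σ : H →L[ℂ] H, IsState ρ → IsState σ →
    (∀ X, MeasurableSet X → trace (ρ * E.eff X) = trace (σ * E.eff X)) → ρ = σ

lemma eff_empty (E : Observable ι H) : E.eff ∅ = 0 := by
  have h := E.sigma_additive (fun _ => ∅) (fun _ => MeasurableSet.empty)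
    (fun _ _ _ => by simp [Function.onFun])
  ext1 ψ
  refine ext_inner_left ℂ fun φ => ?_
  have h1 := (h φ ψ).summable
  rw [summable_const_iff] at h1
  simpa using h1

/-- The finite positive measure `X ↦ ⟨ψ, E(X) ψ⟩`. -/
def measure (E : Observable ι H) (ψ : H) : Measure (ι → ℝ) :=
  Measure.ofMeasurable (fun X _ => ENNReal.ofReal (⟪ψ, E.eff X ψ⟫_ℂ).re)
    (by simp [E.eff_empty])
    (by
      intro X hX hd
      have h := Complex.hasSum_re (E.sigma_additive X hX hd ψ ψ)
      rw [← h.tsum_eq]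
      exact ENNReal.ofReal_tsum_of_nonneg
        (fun j => (E.positive _ (hX j)).re_inner_nonneg_right ψ) h.summable)

lemma measure_apply (E : Observable ι H) (ψ : H) {X : Set (ι → ℝ)} (hX : MeasurableSet X) :
    E.measure ψ X = ENNReal.ofReal (⟪ψ, E.eff X ψ⟫_ℂ).re :=
  Measure.ofMeasurable_apply X hX

/-- `T` is the value at `p` of the characteristic function of `E`, that is,
`T = ∫ exp(i pᵀx) E(dx)`, in the weak sense. (By polarization, the diagonal matrix elements
determine the bounded operator `T`.) -/
def HasCharFun [Fintype ι] (E : Observable ι H) (p : ι → ℝ) (T : H →L[ℂ] H) : Prop :=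
  ∀ ψ : H, ⟪ψ, T ψ⟫_ℂ = ∫ x, Complex.exp (Complex.I * ((p ⬝ᵥ x : ℝ) : ℂ)) ∂(E.measure ψ)

/-- The linear postprocessing `X ↦ E({y | P y ∈ X})` of `E` by a matrix `P`. -/
def postprocess [Fintype ι] [Fintype κ] (E : Observable ι H) (P : Matrix κ ι ℝ) :
    Observable κ H where
  eff X := by
    classical exact if MeasurableSet X then E.eff ((fun y => P *ᵥ y) ⁻¹' X) else 0
  not_measurable X hX := by simp [hX]
  positive X hX := by
    have hP : Measurable (fun y : ι → ℝ => P *ᵥ y) :=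
      (Continuous.matrix_mulVec continuous_const continuous_id).measurable
    simpa [hX] using E.positive _ (hP hX)
  normalized := by simp [E.normalized]
  sigma_additive X hX hd φ ψ := by
    have hP : Measurable (fun y : ι → ℝ => P *ᵥ y) :=
      (Continuous.matrix_mulVec continuous_const continuous_id).measurable
    have h := E.sigma_additive (fun j => (fun y => P *ᵥ y) ⁻¹' X j) (fun j => hP (hX j))
      (fun i j hij => (hd hij).preimage _) φ ψ
    simpa [hX, MeasurableSet.iUnion hX, Set.preimage_iUnion] using h

end Observable

end General

/-! ### The `N`-mode system -/

/-- The Hilbert space `L²(ℝ^N)` of the `N`-mode system. -/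
abbrev ModeSpace (N : ℕ) : Type := Lp ℂ 2 (volume : Measure (Fin N → ℝ))

/-- Indices of the phase space `ℝ^{2N}`: the coordinates of a vector `x` are
`q_j = x (j, 0)` and `p_j = x (j, 1)`. -/
abbrev PhaseIndex (N : ℕ) : Type := Fin N × Fin 2

/-- The symplectic matrix `Ω_N`, the direct sum of `N` blocks `(0, 1; -1, 0)`. -/
def Omega (N : ℕ) : Matrix (PhaseIndex N) (PhaseIndex N) ℝ :=
  (1 : Matrix (Fin N) (Fin N) ℝ) ⊗ₖ !![0, 1; -1, 0]

section Weyl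

variable {N : ℕ}

/-- The function `t ↦ exp(i (p·t - p·q/2)) ψ(t - q)`, for `x = (q₁, p₁, …, q_N, p_N)`. -/
def weylFun (x : PhaseIndex N → ℝ) (ψ : (Fin N → ℝ) → ℂ) (t : Fin N → ℝ) : ℂ :=
  Complex.exp (Complex.I * ((∑ j, (x (j, 1) * t j - x (j, 1) * x (j, 0) / 2) : ℝ) : ℂ)) *
    ψ (fun j => t j - x (j, 0))

lemma measurePreserving_shift (q : Fin N → ℝ) :
    MeasurePreserving (fun (t : Fin N → ℝ) j => t j - q j) volume volume :=
  measurePreserving_sub_right volume q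

lemma norm_weylFun (x : PhaseIndex N → ℝ) (ψ : (Fin N → ℝ) → ℂ) (t : Fin N → ℝ) :
    ‖weylFun x ψ t‖ = ‖ψ (fun j => t j - x (j, 0))‖ := by
  rw [weylFun, norm_mul, mul_comm Complex.I, Complex.norm_exp_ofReal_mul_I, one_mul]

lemma memLp_weylFun (x : PhaseIndex N → ℝ) (ψ : ModeSpace N) :
    MemLp (weylFun x ψ) 2 volume := by
  have h := (Lp.memLp ψ).comp_measurePreserving (measurePreserving_shift fun j => x (j, 0))
  refine h.of_le ?_ (Filter.Eventually.of_forall fun t => (norm_weylFun x ψ t).le)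
  refine AEStronglyMeasurable.mul ?_ h.aestronglyMeasurable
  exact Continuous.aestronglyMeasurable (by fun_prop)

lemma eLpNorm_weylFun (x : PhaseIndex N → ℝ) (ψ : ModeSpace N) :
    eLpNorm (weylFun x ψ) 2 volume = eLpNorm ψ 2 volume := by
  rw [← eLpNorm_comp_measurePreserving (Lp.aestronglyMeasurable ψ)
    (measurePreserving_shift fun j => x (j, 0))]
  exact eLpNorm_congr_norm_ae (Filter.Eventually.of_forall fun t => norm_weylFun x ψ t)

/-- The Weyl operators on `L²(ℝ^N)`. Since
`-i xᵀΩR = i ∑ (p_j Q_j - q_j P_j)`, with `Q_j` the multiplication by `t_j` and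
`P_j = -i ∂/∂t_j`, the operator `W(x) = exp(-i xᵀΩR)` acts by
`(W(x)ψ)(t) = exp(i (p·t - p·q/2)) ψ(t - q)`. -/
def weyl (x : PhaseIndex N → ℝ) : ModeSpace N →L[ℂ] ModeSpace N :=
  LinearIsometry.toContinuousLinearMap
    { toFun := fun ψ => (memLp_weylFun x ψ).toLp
      map_add' := by
        intro φ ψ
        rw [← MemLp.toLp_add, MemLp.toLp_eq_toLp_iff]
        filter_upwards [(measurePreserving_shift fun j => x (j, 0)).quasiMeasurePreserving.ae
          (Lp.coeFn_add φ ψ)] with t ht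
        simp only [weylFun, Pi.add_apply] at ht ⊢
        rw [ht, mul_add]
      map_smul' := by
        intro c ψ
        rw [RingHom.id_apply, ← MemLp.toLp_const_smul, MemLp.toLp_eq_toLp_iff]
        filter_upwards [(measurePreserving_shift fun j => x (j, 0)).quasiMeasurePreserving.ae
          (Lp.coeFn_smul c ψ)] with t ht
        simp only [weylFun, Pi.smul_apply, smul_eq_mul] at ht ⊢
        rw [ht, mul_left_comm]
      norm_map' := by
        intro ψ
        change ‖(memLp_weylFun x ψ).toLp‖ = ‖ψ‖
        rw [Lp.norm_toLp, Lp.norm_def, eLpNorm_weylFun] }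

end Weyl

/-! ### Gaussian and covariant observables -/

namespace Observable

variable {N : ℕ} {ι : Type*}

/-- `E` is the Gaussian observable with parameters `(A, B, v)`: the matrix `B - i AᵀΩA` is positive
semidefinite and the characteristic function of `E` is
`p ↦ exp(-pᵀBp/4 - i vᵀp) W(A p)`. -/
def HasGaussianParameters [Fintype ι] (E : Observable ι (ModeSpace N))
    (A : Matrix (PhaseIndex N) ι ℝ) (B : Matrix ι ι ℝ) (v : ι → ℝ) : Prop :=
  (B.map Complex.ofReal - Complex.I • (Aᵀ * Omega N * A).map Complex.ofReal).PosSemidef ∧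
  ∀ p : ι → ℝ, E.HasCharFun p
    (Complex.exp (-(1 / 4) * ((p ⬝ᵥ B *ᵥ p : ℝ) : ℂ) - Complex.I * ((v ⬝ᵥ p : ℝ) : ℂ)) •
      weyl (A *ᵥ p))

/-- Gaussian observables with values in `ℝ^ι`. -/
def IsGaussian [Fintype ι] (E : Observable ι (ModeSpace N)) : Prop :=
  ∃ A B v, E.HasGaussianParameters A B v

/-- Covariant phase space observables: `W(x) E(X) W(x)* = E(X + x)`. -/
def IsCovariant (E : Observable (PhaseIndex N) (ModeSpace N)) : Prop :=
  ∀ (x : PhaseIndex N → ℝ) (X : Set (PhaseIndex N → ℝ)), MeasurableSet X →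
    weyl x * E.eff X * ContinuousLinearMap.adjoint (weyl x) = E.eff ((fun y => y + x) '' X)

end Observable

end GaussianObs

end

/-! Everything is read off the characteristic function of `E`, which at `p` is a nonzero multiple of
`W(A p)`. Each outcome distribution is a finite measure, hence determined by its Fourier transform.

Covariance: conjugating by `W(x)` multiplies the characteristic function at `p` by `exp(-i xᵀΩAp)`,
by the Weyl relations, while translating the outcomes multiplies it by `exp(-i pᵀx)`. These agree
for all `x`, `p` exactly when `ΩA = 1`, that is, `A = -Ω` (`HasGaussianParameters.isCovariant_iff`).

Informational completeness holds exactly when `A` is invertible. If it is, the outcome distribution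
of `ρ` determines `tr(ρ W(x))` for every `x`, and these numbers determine `ρ`: with `x = (q, p)`
they are, up to phases, the Fourier transforms of the shifted diagonals of its integral kernel
(`tsum_inner_mul_inner_eq_zero`). If `A` is singular, some `W(y)` with `y ≠ 0` commutes with all
`W(A p)`, and `E` cannot separate a vector state from its image under `W(-y)`.

Postprocessing by `P` replaces `A` by `A Pᵀ`, so the invertible `A` are exactly those reached from
`-Ω` by invertible `P`. -/

noncomputable section

namespace GaussianObs

open scoped FourierTransform ContDiff

/-! ### Fourier uniqueness on `ℝ^ι` -/

section Fourier

variable {ι : Type*} [Fintype ι]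

/-- The pairing `(w, t) ↦ w · t` as a bilinear form. -/
def dotForm (ι : Type*) [Fintype ι] :
    EuclideanSpace ℝ ι →ₗ[ℝ] (ι → ℝ) →ₗ[ℝ] ℝ :=
  LinearMap.mk₂ ℝ (fun w t => w.ofLp ⬝ᵥ t) (by simp [add_dotProduct])
    (by simp [smul_dotProduct]) (by simp [dotProduct_add]) (by simp [dotProduct_smul])

/-- An integrable function on `ℝ^ι` whose Fourier transform vanishes is zero almost everywhere. -/
theorem ae_eq_zero_of_integral_exp_mul_eq_zero {h : (ι → ℝ) → ℂ} (hh : Integrable h)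
    (h0 : ∀ p : ι → ℝ, ∫ t, Complex.exp (Complex.I * ((p ⬝ᵥ t : ℝ) : ℂ)) * h t = 0) :
    ∀ᵐ t, h t = 0 := by
  refine ae_eq_zero_of_integral_contDiff_smul_eq_zero hh.locallyIntegrable fun g hg hc => ?_
  let e := EuclideanSpace.equiv ι ℝ
  have hc' : HasCompactSupport fun x : EuclideanSpace ℝ ι => (g (e x) : ℂ) :=
    (hc.comp_homeomorph e.toHomeomorph).comp_left (g := Complex.ofReal) Complex.ofReal_zero
  have hg' : ContDiff ℝ ∞ fun x : EuclideanSpace ℝ ι => (g (e x) : ℂ) :=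
    Complex.ofRealCLM.contDiff.comp (hg.comp e.contDiff)
  -- The test function is written as a Fourier transform `𝓕 K`; Fubini then moves the transform from
  -- `K` onto `h`, where it vanishes.
  let G : SchwartzMap (EuclideanSpace ℝ ι) ℂ := hc'.toSchwartzMap hg'
  let K : SchwartzMap (EuclideanSpace ℝ ι) ℂ := 𝓕⁻ G
  have hK : 𝓕 K = G := by simp [K]
  have hL : Continuous fun p : EuclideanSpace ℝ ι × (ι → ℝ) => dotForm ι p.1 p.2 := by
    change Continuous fun p : EuclideanSpace ℝ ι × (ι → ℝ) => p.1.ofLp ⬝ᵥ p.2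
    fun_prop
  have key := VectorFourier.integral_fourierIntegral_smul_eq_flip (L := dotForm ι)
    (μ := volume) (ν := volume) Real.continuous_fourierChar hL K.integrable hh
  have hz : ∀ x, VectorFourier.fourierIntegral Real.fourierChar volume (dotForm ι).flip h x
      = 0 := by
    intro x
    -- The library transform uses `exp(-2πi x·t)`, hence this rescaling of the frequency.
    rw [← h0 (-(2 * Real.pi) • x.ofLp)]
    refine integral_congr_ae (Filter.Eventually.of_forall fun t => ?_)
    simp only [Circle.smul_def, Real.fourierChar_apply, smul_eq_mul, LinearMap.flip_apply]
    congr 2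
    simp [dotForm, smul_dotProduct]
    ring
  have hG : ∀ t, VectorFourier.fourierIntegral Real.fourierChar volume (dotForm ι) K t
      = (g t : ℂ) := by
    intro t
    have h1 : (𝓕 K) (WithLp.toLp 2 t) = (g t : ℂ) := by
      rw [hK]; rfl
    rw [← h1, SchwartzMap.fourier_coe, Real.fourier_eq]
    refine integral_congr_ae (Filter.Eventually.of_forall fun w => ?_)
    simp only [dotForm, LinearMap.mk₂_apply, PiLp.inner_apply, dotProduct]
    congr 4
    simp [mul_comm]
  simp only [hz, hG, smul_zero, integral_zero] at key
  simpa using key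

/-- Finite measures on `ℝ^ι` with the same characteristic function are equal. -/
theorem measure_ext_of_integral_exp {μ ν : Measure (ι → ℝ)} [IsFiniteMeasure μ]
    [IsFiniteMeasure ν]
    (h : ∀ p : ι → ℝ, ∫ x, Complex.exp (Complex.I * ((p ⬝ᵥ x : ℝ) : ℂ)) ∂μ =
      ∫ x, Complex.exp (Complex.I * ((p ⬝ᵥ x : ℝ) : ℂ)) ∂ν) : μ = ν := by
  classical
  refine Measure.ext_of_charFunDual (funext fun L => ?_)
  have hL : ∀ x, L x = (fun i => L (Pi.single i 1)) ⬝ᵥ x := fun x => by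
    conv_lhs => rw [← Finset.univ_sum_single x]
    simp only [map_sum, dotProduct]
    refine Finset.sum_congr rfl fun i _ => ?_
    rw [mul_comm, ← smul_eq_mul, ← map_smul, ← Pi.single_smul]
    simp
  simp only [charFunDual_apply, mul_comm _ Complex.I]
  convert h fun i => L (Pi.single i 1) using 5 <;> rw [hL]

end Fourier


/-! ### Weyl relations -/

section Weyl

variable {N : ℕ}

theorem coeFn_weyl (x : PhaseIndex N → ℝ) (ψ : ModeSpace N) :
    weyl x ψ =ᵐ[volume] weylFun x ψ :=
  (memLp_weylFun x ψ).coeFn_toLp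

@[simp]
theorem norm_weyl (x : PhaseIndex N → ℝ) (ψ : ModeSpace N) : ‖weyl x ψ‖ = ‖ψ‖ := by
  change ‖(memLp_weylFun x ψ).toLp‖ = ‖ψ‖
  rw [Lp.norm_toLp, Lp.norm_def, eLpNorm_weylFun]

theorem dotProduct_omega_mulVec (x y : PhaseIndex N → ℝ) :
    x ⬝ᵥ Omega N *ᵥ y = ∑ j, (x (j, 0) * y (j, 1) - x (j, 1) * y (j, 0)) := by
  simp only [dotProduct, Matrix.mulVec, Omega, Fintype.sum_prod_type, Fin.sum_univ_two,
    Matrix.kroneckerMap_apply, Matrix.one_apply]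
  refine Finset.sum_congr rfl fun j _ => ?_
  simp
  ring

theorem omega_mul_omega : Omega N * Omega N = -1 := by
  rw [Omega, ← Matrix.mul_kronecker_mul, Matrix.one_mul]
  have : (!![0, 1; -1, 0] * !![0, 1; -1, 0] : Matrix (Fin 2) (Fin 2) ℝ) = (-1 : ℝ) • 1 := by
    ext i j; fin_cases i <;> fin_cases j <;> simp
  rw [this, Matrix.kronecker_smul, Matrix.one_kronecker_one, neg_one_smul]

theorem isUnit_omega : IsUnit (Omega N) :=
  ⟨⟨Omega N, -Omega N, by simp [omega_mul_omega], by simp [omega_mul_omega]⟩, rfl⟩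

/-- The Weyl form of the canonical commutation relations. -/
theorem weyl_mul_weyl (x y : PhaseIndex N → ℝ) :
    weyl x * weyl y =
      Complex.exp (-(Complex.I / 2) * ((x ⬝ᵥ Omega N *ᵥ y : ℝ) : ℂ)) • weyl (x + y) := by
  ext1 ψ
  refine Lp.ext ?_
  have h1 := (measurePreserving_shift fun j => x (j, 0)).quasiMeasurePreserving.ae
    (coeFn_weyl y ψ)
  have h2 := Lp.coeFn_smul (Complex.exp (-(Complex.I / 2) * ((x ⬝ᵥ Omega N *ᵥ y : ℝ) : ℂ)))
    (weyl (x + y) ψ)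
  filter_upwards [coeFn_weyl x (weyl y ψ), h1, h2, coeFn_weyl (x + y) ψ] with t h0 h1 h2 h3
  change (weyl x (weyl y ψ)) t =
    (Complex.exp (-(Complex.I / 2) * ((x ⬝ᵥ Omega N *ᵥ y : ℝ) : ℂ)) • weyl (x + y) ψ) t
  rw [h0, h2, Pi.smul_apply, h3, weylFun, h1, weylFun, weylFun, smul_eq_mul, ← mul_assoc,
    ← mul_assoc, ← Complex.exp_add, ← Complex.exp_add]
  congr 2
  · rw [dotProduct_omega_mulVec]
    push_cast
    simp only [Finset.mul_sum, ← Finset.sum_add_distrib, Pi.add_apply]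
    refine Finset.sum_congr rfl fun j _ => ?_
    push_cast
    ring
  · funext j
    simp [sub_sub]

theorem weyl_zero : weyl (0 : PhaseIndex N → ℝ) = 1 := by
  ext1 ψ
  refine Lp.ext ?_
  filter_upwards [coeFn_weyl 0 ψ] with t h
  rw [h]
  simp [weylFun]

theorem dotProduct_omega_mulVec_self (x : PhaseIndex N → ℝ) : x ⬝ᵥ Omega N *ᵥ x = 0 := by
  rw [dotProduct_omega_mulVec]
  exact Finset.sum_eq_zero fun j _ => by ring

theorem dotProduct_omega_mulVec_swap (x y : PhaseIndex N → ℝ) :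
    y ⬝ᵥ Omega N *ᵥ x = -(x ⬝ᵥ Omega N *ᵥ y) := by
  rw [dotProduct_omega_mulVec, dotProduct_omega_mulVec, ← Finset.sum_neg_distrib]
  exact Finset.sum_congr rfl fun j _ => by ring

theorem weyl_mul_weyl_neg (x : PhaseIndex N → ℝ) : weyl x * weyl (-x) = 1 := by
  rw [weyl_mul_weyl, Matrix.mulVec_neg, dotProduct_neg, dotProduct_omega_mulVec_self]
  simp [weyl_zero]

theorem adjoint_weyl_mul_weyl (x : PhaseIndex N → ℝ) :
    ContinuousLinearMap.adjoint (weyl x) * weyl x = 1 :=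
  (ContinuousLinearMap.norm_map_iff_adjoint_comp_self _).1 (norm_weyl x)

theorem adjoint_weyl (x : PhaseIndex N → ℝ) :
    ContinuousLinearMap.adjoint (weyl x) = weyl (-x) := by
  calc _ = ContinuousLinearMap.adjoint (weyl x) * (weyl x * weyl (-x)) := by
        rw [weyl_mul_weyl_neg, mul_one]
    _ = weyl (-x) := by rw [← mul_assoc, adjoint_weyl_mul_weyl, one_mul]

theorem weyl_mul_weyl_comm (x y : PhaseIndex N → ℝ) :
    weyl x * weyl y =
      Complex.exp (-Complex.I * ((x ⬝ᵥ Omega N *ᵥ y : ℝ) : ℂ)) • (weyl y * weyl x) := by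
  rw [weyl_mul_weyl, weyl_mul_weyl y x, smul_smul, ← Complex.exp_add, add_comm y x,
    dotProduct_omega_mulVec_swap x y]
  congr 2
  push_cast
  ring

theorem weyl_mul_weyl_mul_adjoint (x y : PhaseIndex N → ℝ) :
    weyl x * weyl y * ContinuousLinearMap.adjoint (weyl x) =
      Complex.exp (-Complex.I * ((x ⬝ᵥ Omega N *ᵥ y : ℝ) : ℂ)) • weyl y := by
  rw [weyl_mul_weyl_comm, smul_mul_assoc, mul_assoc, adjoint_weyl, weyl_mul_weyl_neg, mul_one]

instance : Nontrivial (ModeSpace N) := by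
  have hpos : volume (Metric.ball (0 : Fin N → ℝ) 1) ≠ 0 :=
    (Metric.measure_ball_pos volume 0 one_pos).ne'
  have hfin : volume (Metric.ball (0 : Fin N → ℝ) 1) ≠ ⊤ := measure_ball_lt_top.ne
  refine ⟨⟨indicatorConstLp 2 measurableSet_ball hfin 1, 0, fun h => ?_⟩⟩
  have := congrArg norm h
  rw [norm_indicatorConstLp (by simp) (by simp)] at this
  simp [Measure.real] at this

theorem weyl_ne_zero (x : PhaseIndex N → ℝ) : weyl x ≠ 0 := by
  intro h
  have := weyl_mul_weyl_neg x
  rw [h, zero_mul] at this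
  exact zero_ne_one this

/-- A phase space vector annihilated by the symplectic form vanishes. -/
theorem eq_zero_of_forall_omega {y : PhaseIndex N → ℝ} (h : ∀ x, x ⬝ᵥ Omega N *ᵥ y = 0) :
    y = 0 := by
  have h1 : Omega N *ᵥ y = 0 := dotProduct_eq_zero _ fun x => by rw [dotProduct_comm]; exact h x
  have h2 := congrArg (fun z => Omega N *ᵥ z) h1
  simpa [Matrix.mulVec_mulVec, omega_mul_omega, Matrix.neg_mulVec] using h2

/-- For `y ≠ 0` some vector is not an eigenvector of the Weyl operator `W(y)`. -/
theorem exists_weyl_ne_smul {y : PhaseIndex N → ℝ} (hy : y ≠ 0) :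
    ∃ ψ : ModeSpace N, ∀ c : ℂ, weyl y ψ ≠ c • ψ := by
  by_contra! hcon
  -- An operator for which every vector is an eigenvector is a scalar.
  obtain ⟨a, ha⟩ := LinearMap.exists_eq_smul_id_of_forall_notLinearIndependent
    (f := (weyl y : ModeSpace N →ₗ[ℂ] ModeSpace N)) fun ψ hli => by
      obtain ⟨c, hc⟩ := hcon ψ
      have := LinearIndependent.pair_iff.1 hli c (-1) (by simp [hc])
      simp at this
  have hya : weyl y = a • 1 := by
    ext1 ψ
    exact LinearMap.congr_fun ha ψ
  obtain ⟨x, hx⟩ : ∃ x, x ⬝ᵥ Omega N *ᵥ y ≠ 0 := by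
    by_contra! h
    exact hy (eq_zero_of_forall_omega h)
  -- The scaling makes the symplectic form equal to `π`, so the two Weyl operators anticommute; a
  -- scalar `W(y)` would also commute, forcing `W(y) = 0`.
  have h1 := weyl_mul_weyl_comm ((Real.pi / (x ⬝ᵥ Omega N *ᵥ y)) • x) y
  rw [smul_dotProduct, smul_eq_mul, div_mul_cancel₀ _ hx] at h1
  have h2 : Complex.exp (-Complex.I * (Real.pi : ℂ)) = -1 := by
    rw [neg_mul, mul_comm, Complex.exp_neg, Complex.exp_pi_mul_I]; norm_num
  rw [h2, neg_one_smul] at h1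
  have h3 : weyl y * weyl ((Real.pi / (x ⬝ᵥ Omega N *ᵥ y)) • x) =
      weyl ((Real.pi / (x ⬝ᵥ Omega N *ᵥ y)) • x) * weyl y := by
    rw [hya]; simp
  rw [h3] at h1
  rw [eq_neg_iff_add_eq_zero, ← two_smul ℂ, smul_eq_zero_iff_right two_ne_zero] at h1
  have h4 := congrArg (fun T => weyl (-((Real.pi / (x ⬝ᵥ Omega N *ᵥ y)) • x)) * T) h1
  have h5 := weyl_mul_weyl_neg (-((Real.pi / (x ⬝ᵥ Omega N *ᵥ y)) • x))
  rw [neg_neg] at h5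
  simp only [← mul_assoc, h5, one_mul, mul_zero] at h4
  exact weyl_ne_zero y h4

end Weyl


/-! ### The Weyl transform is injective -/

section SumIntegral

variable {α ι : Type*} [MeasurableSpace α] {μ : Measure α}

theorem integrable_tsum_of_summable_integral_norm [Countable ι] {F : ι → α → ℂ}
    (hF : ∀ i, Integrable (F i) μ) (hs : Summable fun i => ∫ a, ‖F i a‖ ∂μ) :
    Integrable (fun a => ∑' i, F i a) μ := by
  refine ⟨(AEMeasurable.tsum fun i => (hF i).aemeasurable).aestronglyMeasurable, ?_⟩
  have h1 : ∀ i, ∫⁻ a, ‖F i a‖ₑ ∂μ = ENNReal.ofReal (∫ a, ‖F i a‖ ∂μ) := fun i =>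
    (ofReal_integral_norm_eq_lintegral_enorm (hF i)).symm
  calc ∫⁻ a, ‖∑' i, F i a‖ₑ ∂μ ≤ ∫⁻ a, ∑' i, ‖F i a‖ₑ ∂μ :=
        lintegral_mono fun a => enorm_tsum_le_tsum_enorm
    _ = ∑' i, ENNReal.ofReal (∫ a, ‖F i a‖ ∂μ) := by
        rw [lintegral_tsum fun i => (hF i).aemeasurable.enorm]
        simp only [h1]
    _ < ⊤ := hs.tsum_ofReal_lt_top

theorem integrable_mul_star_of_memLp {f g : α → ℂ} (hf : MemLp f 2 μ) (hg : MemLp g 2 μ) :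
    Integrable (fun a => g a * starRingEnd ℂ (f a)) μ :=
  hg.integrable_mul hf.star

theorem integral_norm_mul_star_le {f g : α → ℂ} (hf : MemLp f 2 μ) (hg : MemLp g 2 μ) :
    ∫ a, ‖g a * starRingEnd ℂ (f a)‖ ∂μ ≤ (eLpNorm f 2 μ).toReal * (eLpNorm g 2 μ).toReal := by
  rw [integral_norm_eq_lintegral_enorm (integrable_mul_star_of_memLp hf hg).1,
    ← eLpNorm_one_eq_lintegral_enorm, ← ENNReal.toReal_mul, mul_comm]
  refine ENNReal.toReal_mono (ENNReal.mul_ne_top hg.2.ne hf.2.ne) ?_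
  have h := eLpNorm_smul_le_mul_eLpNorm (p := 2) (q := 2) (r := 1) hf.star.1 hg.1
  rwa [eLpNorm_star] at h

end SumIntegral

/-! ### Integral kernels of trace class operators -/

section Injective

variable {N : ℕ} {ι : Type*}

/-- Splitting off the phase that does not depend on `t` exhibits the matrix element as a Fourier
transform in the momentum part of `x`, at fixed position part. -/
theorem inner_weyl_eq (x : PhaseIndex N → ℝ) (f g : ModeSpace N) :
    ⟪f, weyl x g⟫_ℂ =
      Complex.exp (Complex.I * ((-∑ j, x (j, 1) * x (j, 0) / 2 : ℝ) : ℂ)) *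
        ∫ t, Complex.exp (Complex.I * (((fun j => x (j, 1)) ⬝ᵥ t : ℝ) : ℂ)) *
          (g (fun j => t j - x (j, 0)) * starRingEnd ℂ (f t)) := by
  rw [L2.inner_def, ← integral_const_mul]
  refine integral_congr_ae ?_
  filter_upwards [coeFn_weyl x g] with t ht
  rw [ht, RCLike.inner_apply, weylFun, ← mul_assoc, ← mul_assoc, ← Complex.exp_add, ← mul_add,
    ← Complex.ofReal_add, Finset.sum_sub_distrib, dotProduct, sub_eq_add_neg, add_comm]

/-- The kernel `∑ conj (a_j t) b_j s` of the operator `∑ |b_j⟩⟨a_j|`. -/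
def kernel (a b : ι → ModeSpace N) (s t : Fin N → ℝ) : ℂ :=
  ∑' j, b j s * starRingEnd ℂ (a j t)

theorem measurable_kernel [Countable ι] (a b : ι → ModeSpace N) :
    Measurable fun z : (Fin N → ℝ) × (Fin N → ℝ) => kernel a b z.1 z.2 := by
  refine Measurable.tsum fun j => ?_
  exact ((Lp.stronglyMeasurable (b j)).measurable.comp measurable_fst).mul
    (Complex.continuous_conj.measurable.comp
      ((Lp.stronglyMeasurable (a j)).measurable.comp measurable_snd))

/-- Fourier uniqueness for fixed `q`: letting `p` vary, the vanishing Weyl traces say that the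
Fourier transform of the `q`-shifted diagonal of the kernel is zero. -/
theorem kernel_shift_ae_eq_zero [Countable ι] {a b : ι → ModeSpace N}
    (hs : Summable fun j => ‖a j‖ * ‖b j‖)
    (hW : ∀ x, ∑' j, ⟪a j, weyl x (b j)⟫_ℂ = 0) (q : Fin N → ℝ) :
    ∀ᵐ t, kernel a b (fun j => t j - q j) t = 0 := by
  have hb : ∀ j, MemLp (fun t : Fin N → ℝ => b j fun i => t i - q i) 2 volume := fun j =>
    (Lp.memLp (b j)).comp_measurePreserving (measurePreserving_shift q)
  have hint := fun j => integrable_mul_star_of_memLp (Lp.memLp (a j)) (hb j)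
  have hsum : Summable fun j => ∫ t : Fin N → ℝ,
      ‖b j (fun i => t i - q i) * starRingEnd ℂ (a j t)‖ := by
    refine hs.of_nonneg_of_le (fun j => integral_nonneg fun t => norm_nonneg _) fun j => ?_
    refine (integral_norm_mul_star_le (Lp.memLp (a j)) (hb j)).trans_eq ?_
    rw [Lp.norm_def, Lp.norm_def]
    congr 2
    exact eLpNorm_comp_measurePreserving (Lp.aestronglyMeasurable (b j))
      (measurePreserving_shift q)
  refine ae_eq_zero_of_integral_exp_mul_eq_zero
    (integrable_tsum_of_summable_integral_norm hint hsum) fun p => ?_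
  have hn : ∀ t : Fin N → ℝ, ‖Complex.exp (Complex.I * ((p ⬝ᵥ t : ℝ) : ℂ))‖ = 1 := fun t => by
    rw [mul_comm, Complex.norm_exp_ofReal_mul_I]
  have hx := hW fun i => if i.2 = 0 then q i.1 else p i.1
  simp only [inner_weyl_eq, tsum_mul_left, mul_eq_zero, Complex.exp_ne_zero, false_or,
    if_true, one_ne_zero, if_false] at hx
  rw [integral_tsum_of_summable_integral_norm] at hx
  · rw [← hx]
    simp only [tsum_mul_left, kernel]
  · intro j
    refine (hint j).bdd_mul (c := 1) ?_ (Filter.Eventually.of_forall fun t => (hn t).le)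
    exact Continuous.aestronglyMeasurable (by fun_prop)
  · simpa only [norm_mul, hn, one_mul] using hsum

/-- The exceptional null set depends on the shift, so Fubini is applied in the coordinates `(s - t,
t)`; the shear back to `(s, t)` preserves Lebesgue measure. -/
theorem kernel_ae_eq_zero [Countable ι] {a b : ι → ModeSpace N}
    (hs : Summable fun j => ‖a j‖ * ‖b j‖)
    (hW : ∀ x, ∑' j, ⟪a j, weyl x (b j)⟫_ℂ = 0) :
    ∀ᵐ z ∂((volume : Measure (Fin N → ℝ)).prod (volume : Measure (Fin N → ℝ))),
      kernel a b z.1 z.2 = 0 := by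
  have hm : Measurable fun z : (Fin N → ℝ) × (Fin N → ℝ) => kernel a b (z.2 + z.1) z.2 :=
    (measurable_kernel a b).comp ((measurable_snd.add measurable_fst).prodMk measurable_snd)
  have h1 : ∀ᵐ z ∂((volume : Measure (Fin N → ℝ)).prod (volume : Measure (Fin N → ℝ))),
      kernel a b (z.2 + z.1) z.2 = 0 := by
    refine (Measure.ae_prod_iff_ae_ae (p := fun z => kernel a b (z.2 + z.1) z.2 = 0)
      (hm (measurableSet_singleton 0))).2 ?_
    refine Filter.Eventually.of_forall fun r => ?_
    filter_upwards [kernel_shift_ae_eq_zero hs hW (-r)] with t ht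
    convert ht using 2
    funext j
    simp
  filter_upwards [(measurePreserving_sub_prod (volume : Measure (Fin N → ℝ))
    (volume : Measure (Fin N → ℝ))).quasiMeasurePreserving.ae h1] with z hz
  simpa using hz

theorem tsum_inner_mul_inner_eq_zero_of_countable [Countable ι] {a b : ι → ModeSpace N}
    (hs : Summable fun j => ‖a j‖ * ‖b j‖)
    (hW : ∀ x, ∑' j, ⟪a j, weyl x (b j)⟫_ℂ = 0) (φ χ : ModeSpace N) :
    ∑' j, ⟪χ, b j⟫_ℂ * ⟪a j, φ⟫_ℂ = 0 := by
  have e : ∀ j, ⟪χ, b j⟫_ℂ * ⟪a j, φ⟫_ℂ =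
      ∫ z : (Fin N → ℝ) × (Fin N → ℝ), (b j z.1 * starRingEnd ℂ (χ z.1)) *
        (φ z.2 * starRingEnd ℂ (a j z.2)) ∂(volume.prod volume) := fun j => by
    rw [L2.inner_def, L2.inner_def]
    exact (integral_prod_mul (fun s => b j s * starRingEnd ℂ (χ s))
      (fun t => φ t * starRingEnd ℂ (a j t))).symm
  simp only [e]
  rw [integral_tsum_of_summable_integral_norm]
  · refine integral_eq_zero_of_ae ?_
    filter_upwards [kernel_ae_eq_zero hs hW] with z hz
    have : ∀ j, (b j z.1 * starRingEnd ℂ (χ z.1)) * (φ z.2 * starRingEnd ℂ (a j z.2)) =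
        (starRingEnd ℂ (χ z.1) * φ z.2) * (b j z.1 * starRingEnd ℂ (a j z.2)) := fun j => by ring
    simp only [this, tsum_mul_left]
    rw [← kernel, hz, mul_zero, Pi.zero_apply]
  · intro j
    exact (integrable_mul_star_of_memLp (Lp.memLp χ) (Lp.memLp (b j))).mul_prod
      (integrable_mul_star_of_memLp (Lp.memLp (a j)) (Lp.memLp φ))
  · refine (hs.mul_left (‖χ‖ * ‖φ‖)).of_nonneg_of_le
      (fun j => integral_nonneg fun t => norm_nonneg _) fun j => ?_
    simp only [norm_mul (_ * _ : ℂ) (_ * _)]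
    rw [integral_prod_mul (fun s => ‖b j s * starRingEnd ℂ (χ s)‖)
      (fun t => ‖φ t * starRingEnd ℂ (a j t)‖)]
    calc _ ≤ (‖χ‖ * ‖b j‖) * (‖a j‖ * ‖φ‖) := by
          simp only [Lp.norm_def]
          exact mul_le_mul (integral_norm_mul_star_le (Lp.memLp χ) (Lp.memLp (b j)))
            (integral_norm_mul_star_le (Lp.memLp (a j)) (Lp.memLp φ))
            (integral_nonneg fun t => norm_nonneg _) (by positivity)
      _ = _ := by ring

/-- A trace class operator `∑ |b_j⟩⟨a_j|` whose traces against all Weyl operators vanish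
is zero. -/
theorem tsum_inner_mul_inner_eq_zero {a b : ι → ModeSpace N}
    (hs : Summable fun j => ‖a j‖ * ‖b j‖)
    (hW : ∀ x, ∑' j, ⟪a j, weyl x (b j)⟫_ℂ = 0) (φ χ : ModeSpace N) :
    ∑' j, ⟪χ, b j⟫_ℂ * ⟪a j, φ⟫_ℂ = 0 := by
  -- Summability leaves only countably many nonzero terms, so the measurability arguments for
  -- countable sums apply.
  set S := Function.support fun j => ‖a j‖ * ‖b j‖ with hS
  have : Countable S := hs.countable_support
  have h0 : ∀ j ∉ S, a j = 0 ∨ b j = 0 := fun j hj => by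
    simpa [hS, or_iff_not_imp_left] using hj
  have hW' : ∀ x, ∑' j : S, ⟪a j, weyl x (b j)⟫_ℂ = 0 := fun x => by
    rw [tsum_subtype_eq_of_support_subset (f := fun j => ⟪a j, weyl x (b j)⟫_ℂ), hW x]
    intro j hj
    by_contra h
    rcases h0 j h with h | h <;> simp [h] at hj
  rw [← tsum_subtype_eq_of_support_subset (s := S)]
  · exact tsum_inner_mul_inner_eq_zero_of_countable (a := fun j : S => a j)
      (b := fun j : S => b j) (hs.comp_injective Subtype.val_injective) hW' φ χ
  · intro j hj
    by_contra h
    rcases h0 j h with h | h <;> simp [h] at hj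

end Injective


/-! ### Traces and states -/

section Trace

variable {H : Type*} [NormedAddCommGroup H] [InnerProductSpace ℂ H] [CompleteSpace H]

theorem ext_inner_map_self {H : Type*} [NormedAddCommGroup H] [InnerProductSpace ℂ H]
    {S T : H →L[ℂ] H} (h : ∀ ψ, ⟪ψ, S ψ⟫_ℂ = ⟪ψ, T ψ⟫_ℂ) : S = T := by
  have h1 : (S : H →ₗ[ℂ] H) = T := (ext_inner_map _ _).1 fun ψ => by
    rw [← inner_conj_symm, ← inner_conj_symm (T.toLinearMap ψ)]
    exact congrArg _ (h ψ)
  exact ContinuousLinearMap.coe_injective h1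

theorem trace_rankOne_mul (ψ : H) (T : H →L[ℂ] H) :
    trace (InnerProductSpace.rankOne ℂ ψ ψ * T) = ⟪ψ, T ψ⟫_ℂ := by
  rw [← ContinuousLinearMap.adjoint_inner_left, trace,
    ← (basis H).tsum_inner_mul_inner (ContinuousLinearMap.adjoint T ψ) ψ]
  refine tsum_congr fun i => ?_
  rw [ContinuousLinearMap.adjoint_inner_left, mul_apply_eq_comp,
    InnerProductSpace.rankOne_apply, inner_smul_right]

theorem isState_rankOne {ψ : H} (hψ : ‖ψ‖ = 1) :
    IsState (InnerProductSpace.rankOne ℂ ψ ψ) := by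
  refine ⟨InnerProductSpace.isPositive_rankOne_self ψ, ?_⟩
  have h := trace_rankOne_mul ψ 1
  rw [mul_one] at h
  simp [h, inner_self_eq_norm_sq_to_K, hψ]

theorem hasSum_norm_inner_sq {H ι : Type*} [NormedAddCommGroup H]
    [InnerProductSpace ℂ H] (b : HilbertBasis ι ℂ H) (x : H) :
    HasSum (fun i => ‖⟪x, b i⟫_ℂ‖ ^ 2) (‖x‖ ^ 2) := by
  have h := b.hasSum_inner_mul_inner x x
  rw [inner_self_eq_norm_sq_to_K, ← RCLike.ofReal_pow] at h
  have h' : ∀ i, ⟪x, b i⟫_ℂ * ⟪b i, x⟫_ℂ = ((‖⟪x, b i⟫_ℂ‖ ^ 2 : ℝ) : ℂ) := fun i => by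
    rw [← inner_conj_symm (b i) x, RCLike.mul_conj]
    simp
  simp only [h'] at h
  exact Complex.hasSum_re h

/-- The matrix of a Hilbert–Schmidt operator is square summable. -/
theorem summable_norm_inner_sq {H ι : Type*} [NormedAddCommGroup H]
    [InnerProductSpace ℂ H] (b : HilbertBasis ι ℂ H) {A : H →L[ℂ] H}
    (hA : Summable fun i => ‖A (b i)‖ ^ 2) :
    Summable fun z : ι × ι => ‖⟪A (b z.1), b z.2⟫_ℂ‖ ^ 2 := by
  refine (summable_prod_of_nonneg fun z => by positivity).2 ⟨fun i =>
    (hasSum_norm_inner_sq b (A (b i))).summable, ?_⟩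
  simpa only [(hasSum_norm_inner_sq b (A (b _))).tsum_eq] using hA

/-- Cyclicity of the trace, for the square of a selfadjoint Hilbert–Schmidt operator `S`. -/
theorem trace_sq_mul {S : H →L[ℂ] H} (hS : ∀ x y, ⟪S x, y⟫_ℂ = ⟪x, S y⟫_ℂ)
    (hsum : Summable fun i => ‖S (basis H i)‖ ^ 2) (T : H →L[ℂ] H) :
    trace (S * S * T) = ∑' j, ⟪S (basis H j), T (S (basis H j))⟫_ℂ := by
  set b := basis H
  -- Parseval turns the trace into this double series. Its terms are products of two square summable
  -- families, so it converges absolutely and may be summed in the other order.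
  let f : basisIndex H → basisIndex H → ℂ := fun i j => ⟪S (b i), b j⟫_ℂ * ⟪b j, S (T (b i))⟫_ℂ
  have h1 := summable_norm_inner_sq b hsum
  have h2 : Summable fun z : basisIndex H × basisIndex H =>
      ‖⟪(ContinuousLinearMap.adjoint T * S) (b z.1), b z.2⟫_ℂ‖ ^ 2 := by
    refine summable_norm_inner_sq b ((hsum.mul_left (‖ContinuousLinearMap.adjoint T‖ ^ 2)
      ).of_nonneg_of_le (fun i => by positivity) fun i => ?_)
    rw [← mul_pow]
    gcongr
    exact (ContinuousLinearMap.adjoint T).le_opNorm (S (b i))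
  have h3 := (Equiv.prodComm _ _).summable_iff.2 h2
  have hf : Summable (Function.uncurry f) := by
    refine Summable.of_norm_bounded (h1.add h3) fun z => ?_
    have e : ⟪b z.2, S (T (b z.1))⟫_ℂ =
        ⟪(ContinuousLinearMap.adjoint T * S) (b z.2), b z.1⟫_ℂ := by
      rw [mul_apply_eq_comp, ContinuousLinearMap.adjoint_inner_left, hS]
    simp only [Function.uncurry, f, norm_mul, e, Function.comp_apply, Equiv.prodComm_apply,
      Prod.fst_swap, Prod.snd_swap]
    nlinarith [sq_nonneg (‖⟪S (b z.1), b z.2⟫_ℂ‖ -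
      ‖⟪(ContinuousLinearMap.adjoint T * S) (b z.2), b z.1⟫_ℂ‖),
      sq_nonneg (‖⟪S (b z.1), b z.2⟫_ℂ‖),
      sq_nonneg ‖⟪(ContinuousLinearMap.adjoint T * S) (b z.2), b z.1⟫_ℂ‖]
  calc trace (S * S * T) = ∑' i, ∑' j, f i j := by
        refine tsum_congr fun i => ?_
        rw [b.tsum_inner_mul_inner, hS]
        rfl
    _ = ∑' j, ∑' i, f i j := hf.tsum_comm.symm
    _ = _ := by
        refine tsum_congr fun j => ?_
        have e : ∀ i, f i j =
            ⟪ContinuousLinearMap.adjoint T (S (b j)), b i⟫_ℂ * ⟪b i, S (b j)⟫_ℂ := fun i => by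
          simp only [f]
          rw [ContinuousLinearMap.adjoint_inner_left, hS, hS, mul_comm]
        simp only [e]
        rw [b.tsum_inner_mul_inner, ContinuousLinearMap.adjoint_inner_left]

/-- A state is a convergent sum `∑ |ψ_j⟩⟨ψ_j|` of rank one operators. -/
theorem IsState.exists_decomposition {ρ : H →L[ℂ] H} (hρ : IsState ρ) :
    ∃ ψ : basisIndex H → H, (Summable fun j => ‖ψ j‖ ^ 2) ∧
      (∀ T, trace (ρ * T) = ∑' j, ⟪ψ j, T (ψ j)⟫_ℂ) ∧
      ∀ χ φ, HasSum (fun j => ⟪χ, ψ j⟫_ℂ * ⟪ψ j, φ⟫_ℂ) ⟪χ, ρ φ⟫_ℂ := by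
  have hρ0 : 0 ≤ ρ := (ContinuousLinearMap.nonneg_iff_isPositive ρ).2 hρ.1
  set S := CFC.sqrt ρ with hSdef
  have hSS : S * S = ρ := CFC.sqrt_mul_sqrt_self ρ hρ0
  have hSpos : S.IsPositive :=
    (ContinuousLinearMap.nonneg_iff_isPositive S).1 (CFC.sqrt_nonneg ρ)
  have hS : ∀ x y, ⟪S x, y⟫_ℂ = ⟪x, S y⟫_ℂ := hSpos.isSymmetric
  have hsum : Summable fun i => ‖S (basis H i)‖ ^ 2 := by
    -- A divergent `tsum` is `0` by convention, so trace one forces convergence; hence the square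
    -- root of `ρ` is Hilbert–Schmidt.
    have h1 : Summable fun i => ⟪basis H i, ρ (basis H i)⟫_ℂ := by
      by_contra h
      have h2 := hρ.2
      rw [trace, tsum_eq_zero_of_not_summable h] at h2
      exact zero_ne_one h2
    have h2 : ∀ i, ⟪basis H i, ρ (basis H i)⟫_ℂ = ((‖S (basis H i)‖ ^ 2 : ℝ) : ℂ) := fun i => by
      rw [← hSS, mul_apply_eq_comp, ← hS, inner_self_eq_norm_sq_to_K]
      simp
    simp only [h2] at h1
    exact_mod_cast h1
  refine ⟨fun j => S (basis H j), hsum, fun T => ?_, fun χ φ => ?_⟩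
  · rw [← hSS, trace_sq_mul hS hsum]
  · rw [← hSS, mul_apply_eq_comp, ← hS]
    simpa only [hS] using (basis H).hasSum_inner_mul_inner (S χ) (S φ)

end Trace

/-! ### Measures and characteristic functions of observables -/

namespace Observable

variable {H : Type*} [NormedAddCommGroup H] [InnerProductSpace ℂ H] [CompleteSpace H]
variable {ι κ : Type*}

theorem inner_eff_eq_ofReal (E : Observable ι H) (ψ : H) {X : Set (ι → ℝ)}
    (hX : MeasurableSet X) : ⟪ψ, E.eff X ψ⟫_ℂ = ((E.measure ψ).real X : ℂ) := by
  have h0 : 0 ≤ ⟪ψ, E.eff X ψ⟫_ℂ := (E.positive X hX).inner_nonneg_right ψ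
  rw [Measure.real, E.measure_apply ψ hX, ENNReal.toReal_ofReal (Complex.nonneg_iff.1 h0).1]
  exact Complex.ext (by simp) (by simpa using (Complex.nonneg_iff.1 h0).2.symm)

theorem measure_univ_eq (E : Observable ι H) (ψ : H) :
    E.measure ψ Set.univ = ENNReal.ofReal (‖ψ‖ ^ 2) := by
  rw [E.measure_apply ψ MeasurableSet.univ, E.normalized, one_apply_eq_self,
    inner_self_eq_norm_sq_to_K]
  norm_cast

instance (E : Observable ι H) (ψ : H) : IsFiniteMeasure (E.measure ψ) :=
  ⟨by rw [measure_univ_eq]; exact ENNReal.ofReal_lt_top⟩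

variable [Fintype ι] [Fintype κ]

theorem integrable_exp {μ : Measure (ι → ℝ)} [IsFiniteMeasure μ] (p : ι → ℝ) :
    Integrable (fun x => Complex.exp (Complex.I * ((p ⬝ᵥ x : ℝ) : ℂ))) μ := by
  refine Integrable.of_bound (C := 1) (Continuous.aestronglyMeasurable (by fun_prop))
    (Filter.Eventually.of_forall fun x => ?_)
  rw [mul_comm, Complex.norm_exp_ofReal_mul_I]

theorem measure_postprocess (E : Observable ι H) (P : Matrix κ ι ℝ) (ψ : H) :
    (E.postprocess P).measure ψ = (E.measure ψ).map fun y => P *ᵥ y := by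
  have hP : Measurable (fun y : ι → ℝ => P *ᵥ y) :=
    (Continuous.matrix_mulVec continuous_const continuous_id).measurable
  refine Measure.ext fun X hX => ?_
  rw [Measure.map_apply hP hX, measure_apply _ _ hX, measure_apply _ _ (hP hX)]
  simp [postprocess, hX]

theorem HasCharFun.postprocess {E : Observable ι H} (P : Matrix κ ι ℝ) {p : κ → ℝ}
    {T : H →L[ℂ] H} (h : E.HasCharFun (Pᵀ *ᵥ p) T) : (E.postprocess P).HasCharFun p T := by
  have hP : Measurable (fun y : ι → ℝ => P *ᵥ y) :=
    (Continuous.matrix_mulVec continuous_const continuous_id).measurable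
  intro ψ
  rw [h ψ, measure_postprocess, integral_map hP.aemeasurable
    (Continuous.aestronglyMeasurable (by fun_prop))]
  simp only [Matrix.mulVec_transpose, Matrix.dotProduct_mulVec]

theorem postprocess_postprocess_inv [DecidableEq ι] (E : Observable ι H) {P : Matrix ι ι ℝ}
    (hP : IsUnit P) : (E.postprocess P⁻¹).postprocess P = E := by
  have hm : Measurable (fun y : ι → ℝ => P *ᵥ y) :=
    (Continuous.matrix_mulVec continuous_const continuous_id).measurable
  ext1
  funext X
  by_cases hX : MeasurableSet X
  · have h2 : (fun y => P⁻¹ *ᵥ y) ⁻¹' ((fun y => P *ᵥ y) ⁻¹' X) = X := by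
      ext y
      simp [Matrix.mulVec_mulVec, Matrix.mul_nonsing_inv P ((Matrix.isUnit_iff_isUnit_det P).1 hP)]
    simp [postprocess, hX, hm hX, h2]
  · rw [not_measurable _ X hX, not_measurable _ X hX]

end Observable


namespace Observable

/-! ### Covariance and informational completeness of Gaussian observables -/

section OutcomeDistribution

variable {H : Type*} [NormedAddCommGroup H] [InnerProductSpace ℂ H] [CompleteSpace H]
variable {ι J : Type*}

theorem summable_measureReal (E : Observable ι H) {ψ : J → H}
    (hψ : Summable fun j => ‖ψ j‖ ^ 2) (X : Set (ι → ℝ)) :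
    Summable fun j => (E.measure (ψ j)).real X := by
  refine hψ.of_nonneg_of_le (fun j => measureReal_nonneg) fun j => ?_
  refine (measureReal_mono (Set.subset_univ X)).trans_eq ?_
  rw [Measure.real, measure_univ_eq, ENNReal.toReal_ofReal (by positivity)]

/-- The outcome distribution of the mixture `∑ |ψ_j⟩⟨ψ_j|`. -/
theorem sum_measure_apply (E : Observable ι H) {ψ : J → H}
    (hψ : Summable fun j => ‖ψ j‖ ^ 2) {X : Set (ι → ℝ)} (hX : MeasurableSet X) :
    Measure.sum (fun j => E.measure (ψ j)) X =
      ENNReal.ofReal (∑' j, ⟪ψ j, E.eff X (ψ j)⟫_ℂ).re := by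
  simp only [inner_eff_eq_ofReal E _ hX]
  rw [← Complex.ofReal_tsum, Complex.ofReal_re, Measure.sum_apply _ hX,
    ENNReal.ofReal_tsum_of_nonneg (fun j => measureReal_nonneg) (summable_measureReal E hψ X)]
  exact tsum_congr fun j => (ofReal_measureReal).symm

theorem isFiniteMeasure_sum (E : Observable ι H) {ψ : J → H}
    (hψ : Summable fun j => ‖ψ j‖ ^ 2) :
    IsFiniteMeasure (Measure.sum fun j => E.measure (ψ j)) :=
  ⟨by rw [sum_measure_apply E hψ MeasurableSet.univ]; exact ENNReal.ofReal_lt_top⟩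

/-- Turns equality of outcome distributions of two mixtures into equality of their traces against
`T`. -/
theorem hasSum_inner_of_hasCharFun [Fintype ι] {E : Observable ι H} {ψ : J → H}
    (hψ : Summable fun j => ‖ψ j‖ ^ 2) {p : ι → ℝ} {T : H →L[ℂ] H} (h : E.HasCharFun p T) :
    HasSum (fun j => ⟪ψ j, T (ψ j)⟫_ℂ)
      (∫ x, Complex.exp (Complex.I * ((p ⬝ᵥ x : ℝ) : ℂ))
        ∂(Measure.sum fun j => E.measure (ψ j))) := by
  have := isFiniteMeasure_sum E hψ
  simp only [h _]
  exact hasSum_integral_measure (integrable_exp p)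

end OutcomeDistribution

variable {N : ℕ}

/-- If the characteristic function of `E` runs through nonzero multiples of all Weyl operators,
then `E` is informationally complete. -/
theorem informationallyComplete_of_forall_weyl {ι : Type*} [Fintype ι]
    {E : Observable ι (ModeSpace N)}
    (h : ∀ x, ∃ (p : ι → ℝ) (c : ℂ), c ≠ 0 ∧ E.HasCharFun p (c • weyl x)) :
    E.InformationallyComplete := by
  intro ρ σ hρ hσ hE
  obtain ⟨ψ, hψ, hψT, hψρ⟩ := hρ.exists_decomposition
  obtain ⟨ξ, hξ, hξT, hξσ⟩ := hσ.exists_decomposition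
  have hμ : (Measure.sum fun j => E.measure (ψ j)) = Measure.sum fun j => E.measure (ξ j) :=
    Measure.ext fun X hX => by
      rw [sum_measure_apply E hψ hX, sum_measure_apply E hξ hX, ← hψT, ← hξT, hE X hX]
  -- The families are chosen so that `∑ |b_j⟩⟨a_j| = ρ - σ`.
  let a := Sum.elim ψ ξ
  let b := Sum.elim ψ fun j => -ξ j
  have hs : Summable fun j => ‖a j‖ * ‖b j‖ := by
    refine Summable.sum _ ?_ ?_
    · simpa [a, b, Function.comp_def, ← sq] using hψ
    · simpa [a, b, Function.comp_def, ← sq] using hξ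
  have hW : ∀ x, ∑' j, ⟪a j, weyl x (b j)⟫_ℂ = 0 := by
    intro x
    obtain ⟨p, c, hc, hp⟩ := h x
    have h1 := hasSum_inner_of_hasCharFun hψ hp
    have h2 := hasSum_inner_of_hasCharFun hξ hp
    rw [← hμ] at h2
    have h3 : HasSum (fun j => c * ⟪a j, weyl x (b j)⟫_ℂ) 0 := by
      rw [← add_neg_cancel (∫ x, Complex.exp (Complex.I * ((p ⬝ᵥ x : ℝ) : ℂ))
        ∂(Measure.sum fun j => E.measure (ψ j)))]
      refine HasSum.sum ?_ ?_
      · simpa [a, b, Function.comp_def, inner_smul_right] using h1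
      · simpa [a, b, Function.comp_def, inner_smul_right] using h2.neg
    have h4 := h3.tsum_eq
    rw [tsum_mul_left] at h4
    exact (mul_eq_zero.1 h4).resolve_left hc
  ext1 φ
  refine ext_inner_left ℂ fun χ => ?_
  have h1 : HasSum (fun j => ⟪χ, b j⟫_ℂ * ⟪a j, φ⟫_ℂ) (⟪χ, ρ φ⟫_ℂ + -⟪χ, σ φ⟫_ℂ) := by
    refine HasSum.sum ?_ ?_
    · simpa [a, b, Function.comp_def] using hψρ χ φ
    · simpa [a, b, Function.comp_def] using (hξσ χ φ).neg
  rw [← sub_eq_zero, sub_eq_add_neg, ← h1.tsum_eq]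
  exact tsum_inner_mul_inner_eq_zero hs hW φ χ

/-- A pushforward under `P` has its Fourier transform evaluated at `Pᵀ p`; the positivity condition
is preserved by congruence with `P`. -/
theorem HasGaussianParameters.postprocess {E : Observable (PhaseIndex N) (ModeSpace N)}
    {A B : Matrix (PhaseIndex N) (PhaseIndex N) ℝ} {v : PhaseIndex N → ℝ}
    (h : E.HasGaussianParameters A B v) (P : Matrix (PhaseIndex N) (PhaseIndex N) ℝ) :
    (E.postprocess P).HasGaussianParameters (A * Pᵀ) (P * B * Pᵀ) (P *ᵥ v) := by
  refine ⟨?_, fun p => ?_⟩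
  · have h1 := h.1.mul_mul_conjTranspose_same (P.map Complex.ofReal)
    convert h1 using 1
    have e : (P.map Complex.ofReal)ᴴ = Pᵀ.map Complex.ofReal := by
      ext i j
      simp [Matrix.conjTranspose_apply]
    have hm : ∀ X Y : Matrix (PhaseIndex N) (PhaseIndex N) ℝ,
        (X * Y).map Complex.ofReal = X.map Complex.ofReal * Y.map Complex.ofReal :=
      fun X Y => Matrix.map_mul (f := Complex.ofRealHom)
    simp only [e, hm, Matrix.transpose_mul, Matrix.transpose_transpose, mul_sub, sub_mul,
      Matrix.mul_smul, Matrix.smul_mul, Matrix.mul_assoc]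
  · have h1 := HasCharFun.postprocess P (h.2 (Pᵀ *ᵥ p))
    convert h1 using 3
    · have e1 : p ⬝ᵥ (P * B * Pᵀ) *ᵥ p = Pᵀ *ᵥ p ⬝ᵥ B *ᵥ Pᵀ *ᵥ p := by
        rw [Matrix.mulVec_mulVec, Matrix.mulVec_transpose, ← Matrix.dotProduct_mulVec,
          Matrix.mulVec_mulVec, Matrix.mul_assoc]
      have e2 : P *ᵥ v ⬝ᵥ p = v ⬝ᵥ Pᵀ *ᵥ p := by
        rw [Matrix.dotProduct_mulVec, Matrix.vecMul_transpose]
      rw [e1, e2]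
    · rw [Matrix.mulVec_mulVec]

theorem measure_apply_shift {ι H : Type*} [NormedAddCommGroup H] [InnerProductSpace ℂ H]
    [CompleteSpace H] [Fintype ι] (E : Observable ι H) (ψ : H) (x : ι → ℝ) {X : Set (ι → ℝ)}
    (hX : MeasurableSet X) :
    ((E.measure ψ).map fun y => y - x) X = E.measure ψ ((fun y => y + x) '' X) := by
  rw [Measure.map_apply (measurable_sub_const x) hX, Set.image_add_right]
  simp [sub_eq_add_neg]

/-- Covariance in terms of the outcome distributions of vector states. -/
theorem isCovariant_iff_measure (E : Observable (PhaseIndex N) (ModeSpace N)) :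
    E.IsCovariant ↔ ∀ x ψ, E.measure (ContinuousLinearMap.adjoint (weyl x) ψ) =
      (E.measure ψ).map fun y => y - x := by
  have hm : ∀ (x : PhaseIndex N → ℝ) {X : Set (PhaseIndex N → ℝ)}, MeasurableSet X →
      MeasurableSet ((fun y => y + x) '' X) := fun x X hX => by
    rw [Set.image_add_right]
    exact measurable_add_const _ hX
  have hin : ∀ x (ψ : ModeSpace N) X,
      ⟪ψ, (weyl x * E.eff X * ContinuousLinearMap.adjoint (weyl x)) ψ⟫_ℂ =
      ⟪ContinuousLinearMap.adjoint (weyl x) ψ,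
        E.eff X (ContinuousLinearMap.adjoint (weyl x) ψ)⟫_ℂ := fun x ψ X => by
    rw [ContinuousLinearMap.adjoint_inner_left]
    rfl
  refine ⟨fun h x ψ => Measure.ext fun X hX => ?_, fun h x X hX => ?_⟩
  · rw [measure_apply_shift _ _ _ hX, measure_apply _ _ hX, measure_apply _ _ (hm x hX), ← hin,
      h x X hX]
  · refine ext_inner_map_self fun ψ => ?_
    rw [hin, inner_eff_eq_ofReal _ _ hX, inner_eff_eq_ofReal _ _ (hm x hX), Measure.real, h,
      measure_apply_shift _ _ _ hX, Measure.real]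

theorem integral_exp_map_sub {ι : Type*} [Fintype ι] (μ : Measure (ι → ℝ)) (p x : ι → ℝ) :
    ∫ y, Complex.exp (Complex.I * ((p ⬝ᵥ y : ℝ) : ℂ)) ∂(μ.map fun y => y - x) =
      Complex.exp (-Complex.I * ((p ⬝ᵥ x : ℝ) : ℂ)) *
        ∫ y, Complex.exp (Complex.I * ((p ⬝ᵥ y : ℝ) : ℂ)) ∂μ := by
  rw [integral_map (measurable_sub_const x).aemeasurable
    (Continuous.aestronglyMeasurable (by fun_prop)), ← integral_const_mul]
  congr 1
  funext y
  rw [← Complex.exp_add, dotProduct_sub]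
  congr 1
  push_cast
  ring

theorem inner_adjoint_weyl_smul_weyl (c : ℂ) (x y : PhaseIndex N → ℝ) (ψ : ModeSpace N) :
    ⟪ContinuousLinearMap.adjoint (weyl x) ψ,
      (c • weyl y) (ContinuousLinearMap.adjoint (weyl x) ψ)⟫_ℂ =
      Complex.exp (-Complex.I * ((x ⬝ᵥ Omega N *ᵥ y : ℝ) : ℂ)) * ⟪ψ, (c • weyl y) ψ⟫_ℂ := by
  have h := congrArg (fun T => ⟪ψ, T ψ⟫_ℂ) (weyl_mul_weyl_mul_adjoint x y)
  simp only [smul_apply, inner_smul_right] at h ⊢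
  rw [ContinuousLinearMap.adjoint_inner_left, mul_left_comm, ← h]
  rfl

theorem eq_zero_of_forall_exp_eq_one {r : ℝ}
    (h : ∀ s : ℝ, Complex.exp (Complex.I * ((s * r : ℝ) : ℂ)) = 1) : r = 0 := by
  by_contra hr
  have h1 := h (Real.pi / r)
  rw [div_mul_cancel₀ _ hr, mul_comm, Complex.exp_pi_mul_I] at h1
  norm_num at h1

theorem HasGaussianParameters.isCovariant_iff {F : Observable (PhaseIndex N) (ModeSpace N)}
    {A B : Matrix (PhaseIndex N) (PhaseIndex N) ℝ} {v : PhaseIndex N → ℝ}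
    (h : F.HasGaussianParameters A B v) : F.IsCovariant ↔ A = -Omega N := by
  rw [isCovariant_iff_measure]
  constructor
  · intro hcov
    have key : ∀ x p : PhaseIndex N → ℝ, x ⬝ᵥ Omega N *ᵥ (A *ᵥ p) = p ⬝ᵥ x := by
      have h1 : ∀ x p : PhaseIndex N → ℝ,
          Complex.exp (-Complex.I * ((x ⬝ᵥ Omega N *ᵥ (A *ᵥ p) : ℝ) : ℂ)) =
          Complex.exp (-Complex.I * ((p ⬝ᵥ x : ℝ) : ℂ)) := by
        intro x p
        by_contra hne
        -- If the phases differed, every diagonal matrix element of `W(A p)` would vanish, and so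
        -- would `W(A p)` by polarization.
        refine weyl_ne_zero (A *ᵥ p) (ext_inner_map_self fun ψ => ?_)
        have h2 := h.2 p (ContinuousLinearMap.adjoint (weyl x) ψ)
        rw [hcov, integral_exp_map_sub, inner_adjoint_weyl_smul_weyl, ← h.2 p,
          mul_eq_mul_right_iff] at h2
        simpa [inner_smul_right] using h2.resolve_left hne
      intro x p
      rw [← sub_eq_zero]
      -- Equal phases fix the exponents only modulo `2π`; scaling `x` by all real `s` removes the
      -- ambiguity.
      refine eq_zero_of_forall_exp_eq_one fun s => ?_
      have h2 := h1 (s • x) p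
      rw [smul_dotProduct, dotProduct_smul] at h2
      have h3 : Complex.exp (Complex.I * ((s * (x ⬝ᵥ Omega N *ᵥ (A *ᵥ p) - p ⬝ᵥ x) : ℝ) : ℂ)) =
          Complex.exp (-Complex.I * ((s • (p ⬝ᵥ x) : ℝ) : ℂ)) /
          Complex.exp (-Complex.I * ((s • (x ⬝ᵥ Omega N *ᵥ (A *ᵥ p)) : ℝ) : ℂ)) := by
        rw [← Complex.exp_sub]
        congr 1
        simp only [smul_eq_mul]
        push_cast
        ring
      rw [h3, h2, div_self (Complex.exp_ne_zero _)]
    have hOA : Omega N * A = 1 := by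
      refine Matrix.ext_of_mulVec_single fun i => ?_
      refine dotProduct_eq _ _ fun x => ?_
      rw [dotProduct_comm, ← Matrix.mulVec_mulVec, key, Matrix.one_mulVec]
    have h4 := congrArg (fun M => Omega N * M) hOA
    simp only [← mul_assoc, omega_mul_omega, neg_mul, one_mul, mul_one] at h4
    rw [← h4, neg_neg]
  · rintro rfl x ψ
    have : IsFiniteMeasure ((F.measure ψ).map fun y => y - x) :=
      Measure.isFiniteMeasure_map _ _
    refine measure_ext_of_integral_exp fun p => ?_
    rw [integral_exp_map_sub, ← h.2 p, ← h.2 p, inner_adjoint_weyl_smul_weyl,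
      Matrix.mulVec_mulVec, mul_neg, omega_mul_omega, neg_neg, Matrix.one_mulVec,
      dotProduct_comm x p]

theorem HasGaussianParameters.informationallyComplete
    {E : Observable (PhaseIndex N) (ModeSpace N)}
    {A B : Matrix (PhaseIndex N) (PhaseIndex N) ℝ} {v : PhaseIndex N → ℝ}
    (h : E.HasGaussianParameters A B v) (hA : IsUnit A) : E.InformationallyComplete := by
  refine informationallyComplete_of_forall_weyl fun x => ?_
  have h1 := h.2 (A⁻¹ *ᵥ x)
  rw [Matrix.mulVec_mulVec x A, Matrix.mul_nonsing_inv A ((Matrix.isUnit_iff_isUnit_det A).1 hA),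
    Matrix.one_mulVec] at h1
  exact ⟨_, _, Complex.exp_ne_zero _, h1⟩

/-- If `A` is singular, then some Weyl operator `W(y)`, `y ≠ 0`, is a symmetry of `E`, so that
`E` does not distinguish a vector state `ψ` from `W(y) ψ`. -/
theorem HasGaussianParameters.isUnit_of_informationallyComplete
    {E : Observable (PhaseIndex N) (ModeSpace N)}
    {A B : Matrix (PhaseIndex N) (PhaseIndex N) ℝ} {v : PhaseIndex N → ℝ}
    (h : E.HasGaussianParameters A B v) (hE : E.InformationallyComplete) : IsUnit A := by
  by_contra hA
  have hdet : (Omega N * A).det = 0 := by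
    rw [Matrix.isUnit_iff_isUnit_det, isUnit_iff_ne_zero, not_not] at hA
    rw [Matrix.det_mul, hA, mul_zero]
  -- This `y` is symplectically orthogonal to the range of `A`, so conjugation by `W(y)` fixes every
  -- `W(A p)`.
  obtain ⟨y, hy, hyA⟩ := Matrix.exists_vecMul_eq_zero_iff.2 hdet
  have hsymm : ∀ p, y ⬝ᵥ Omega N *ᵥ (A *ᵥ p) = 0 := fun p => by
    rw [Matrix.mulVec_mulVec, Matrix.dotProduct_mulVec, hyA, zero_dotProduct]
  obtain ⟨ψ, hψ⟩ := exists_weyl_ne_smul (neg_ne_zero.2 hy)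
  have hψ0 : ψ ≠ 0 := fun h0 => hψ 0 (by simp [h0])
  wlog hn : ‖ψ‖ = 1 generalizing ψ
  · refine this ((‖ψ‖⁻¹ : ℂ) • ψ) (fun c hc => hψ c ?_) (by simpa using hψ0)
      (by rw [norm_smul]; simp [hψ0])
    rw [map_smul, smul_comm] at hc
    exact smul_right_injective _ (inv_ne_zero (by simpa using hψ0)) hc
  have hmeas : E.measure (weyl (-y) ψ) = E.measure ψ := by
    refine measure_ext_of_integral_exp fun p => ?_
    rw [← h.2 p, ← h.2 p, ← adjoint_weyl, inner_adjoint_weyl_smul_weyl, hsymm]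
    simp
  have hst := hE _ _ (isState_rankOne (ψ := weyl (-y) ψ) (by rw [norm_weyl, hn]))
    (isState_rankOne hn) fun X hX => by
      rw [trace_rankOne_mul, trace_rankOne_mul, inner_eff_eq_ofReal _ _ hX,
        inner_eff_eq_ofReal _ _ hX, hmeas]
  -- Equal rank one projections, applied to `W(-y) ψ`, would make `ψ` an eigenvector of `W(-y)`.
  have h1 := congrArg (fun T => T (weyl (-y) ψ)) hst
  simp only [InnerProductSpace.rankOne_apply, inner_self_eq_norm_sq_to_K, norm_weyl, hn] at h1
  refine hψ ⟪ψ, weyl (-y) ψ⟫_ℂ ?_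
  simpa using h1

end Observable

end GaussianObs

end

/-! ### Proof of the main theorem -/

theorem mainTheorem5 (N : ℕ) :
    (∀ E : GaussianObs.Observable (GaussianObs.PhaseIndex N) (GaussianObs.ModeSpace N),
      E.IsGaussian →
      (E.InformationallyComplete ↔
        ∃ (F : GaussianObs.Observable (GaussianObs.PhaseIndex N) (GaussianObs.ModeSpace N))
          (P : Matrix (GaussianObs.PhaseIndex N) (GaussianObs.PhaseIndex N) ℝ),
          F.IsGaussian ∧ F.IsCovariant ∧ IsUnit P ∧ E = F.postprocess P)) ∧
    (∀ (F : GaussianObs.Observable (GaussianObs.PhaseIndex N) (GaussianObs.ModeSpace N))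
      (A B : Matrix (GaussianObs.PhaseIndex N) (GaussianObs.PhaseIndex N) ℝ)
      (v : GaussianObs.PhaseIndex N → ℝ),
      F.HasGaussianParameters A B v → (F.IsCovariant ↔ A = -GaussianObs.Omega N)) := by
  refine ⟨fun E hE => ⟨fun hic => ?_, ?_⟩, fun F A B v h => h.isCovariant_iff⟩
  · obtain ⟨A, B, v, h⟩ := hE
    have hA := h.isUnit_of_informationallyComplete hic
    have hdet := (Matrix.isUnit_iff_isUnit_det A).1 hA
    -- The matrix `Q = (-(A⁻¹ Ω))ᵀ` solves `A Qᵀ = -Ω`, so postprocessing `E` by `Q` gives a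
    -- covariant observable, and `Q⁻¹` recovers `E`.
    have hQ : IsUnit (-(A⁻¹ * GaussianObs.Omega N))ᵀ :=
      (Matrix.isUnit_transpose _).2 ((Matrix.isUnit_nonsing_inv_iff.2 hA).mul
        GaussianObs.isUnit_omega).neg
    have h1 := h.postprocess (-(A⁻¹ * GaussianObs.Omega N))ᵀ
    refine ⟨_, ((-(A⁻¹ * GaussianObs.Omega N))ᵀ)⁻¹, ⟨_, _, _, h1⟩, h1.isCovariant_iff.2 ?_,
      Matrix.isUnit_nonsing_inv_iff.2 hQ, ?_⟩
    · rw [Matrix.transpose_transpose, mul_neg, Matrix.mul_nonsing_inv_cancel_left A _ hdet]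
    · have h2 := E.postprocess_postprocess_inv (Matrix.isUnit_nonsing_inv_iff.2 hQ)
      rw [Matrix.nonsing_inv_nonsing_inv _ ((Matrix.isUnit_iff_isUnit_det _).1 hQ)] at h2
      exact h2.symm
  · rintro ⟨F, P, ⟨A, B, v, h⟩, hcov, hP, rfl⟩
    obtain rfl := h.isCovariant_iff.1 hcov
    -- The first parameter is now `-Ω Pᵀ`, a product of invertible matrices.
    refine (h.postprocess P).informationallyComplete ?_
    exact GaussianObs.isUnit_omega.neg.mul ((Matrix.isUnit_transpose P).2 hP)
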